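/- Fix dimensions $d_A \le d_B$ and let $\mathcal H_A=\mathbb C^{d_A}$, $\mathcal H_B=\mathbb C^{d_B}$. A property of mixed states on a finite-dimensional Hilbert space $\mathcal H$ is a pair $\mathcal P=(\mathcal P^{\mathrm{yes}},\mathcal P^{\mathrm{no}})$ of disjoint sets of density operators on $\mathcal H$ (positive semidefinite, trace one). For real numbers $0\le s<c\le 1$, a $(c,s)$-tester for $\mathcal P$ with sample complexity $N\in\{0,1,2,\dots\}$ is an operator $\mathcal T$ on $\mathcal H^{\otimes N}$ with $0\sqsubseteq\mathcal T\sqsubseteq I$ in the Löwner order such that $\operatorname{tr}[\mathcal T\rho^{\otimes N}]\ge c$ for every $\rho\in\mathcal P^{\mathrm{yes}}$ and $\operatorname{tr}[\mathcal T\rho^{\otimes N}]\le s$ for every $\rho\in\mathcal P^{\mathrm{no}}$. The $(c,s)$-sample complexity $\mathsf S_{c,s}(\mathcal P)$ is the least $N$ for which such a tester exists, and $\infty$ if there is none. For a set $\mathcal R$ of density operators on $\mathcal H_A$ let $$\mathsf{Purify}(\mathcal R)=\{\,|\psi\rangle\in\mathcal H_A\otimes\mathcal H_B : \||\psi\rangle\|=1,\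 \operatorname{tr}_B(|\psi\rangle\langle\psi|)\in\mathcal R\,\},$$ and for a property $\mathcal Q=(\mathcal Q^{\mathrm{yes}},\mathcal Q^{\mathrm{no}})$ of mixed states on $\mathcal H_A$ let $\mathsf{Purify}(\mathcal Q)=(\mathsf{Purify}(\mathcal Q^{\mathrm{yes}}),\mathsf{Purify}(\mathcal Q^{\mathrm{no}}))$, regarded as a property of states on $\mathcal H_A\otimes\mathcal H_B$ by identifying $|\psi\rangle$ with $|\psi\rangle\langle\psi|$. Then for every property $\mathcal Q$ of mixed states on $\mathcal H_A$ and all real $0\le s<c\le1$, $$\mathsf S_{c,s}(\mathsf{Purify}(\mathcal Q))=\mathsf S_{c,s}(\mathcal Q).$$ -/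

import Mathlib

open scoped ComplexOrder

/-- A density matrix on `ℂ^ι` (a mixed quantum state): positive semidefinite of trace one. -/
def IsDensityMatrix {ι : Type*} [Fintype ι] (ρ : Matrix ι ι ℂ) : Prop :=
  ρ.PosSemidef ∧ ρ.trace = 1

/-- A property of mixed states on `ℂ^ι`: a pair of disjoint sets of density matrices. -/
structure StateProperty (ι : Type*) [Fintype ι] where
  yes : Set (Matrix ι ι ℂ)
  no : Set (Matrix ι ι ℂ)
  yes_density : ∀ ρ ∈ yes, IsDensityMatrix ρ
  no_density : ∀ ρ ∈ no, IsDensityMatrix ρ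
  disj : Disjoint yes no

/-- The tensor power `ρ^{⊗N}`, a matrix on `(ℂ^ι)^{⊗N}`, whose standard basis is indexed by
the words `Fin N → ι`. -/
def tensorPower {ι : Type*} (N : ℕ) (ρ : Matrix ι ι ℂ) :
    Matrix (Fin N → ι) (Fin N → ι) ℂ :=
  Matrix.of fun i j => ∏ k, ρ (i k) (j k)

/-- `T` is a `(c, s)`-tester with sample complexity `N` for the property `P`: an operator on
`(ℂ^ι)^{⊗N}` with `0 ⊑ T ⊑ I` in the Löwner order that accepts every yes-instance with
probability at least `c` and every no-instance with probability at most `s`. The trace is a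
real number, since both factors are positive semidefinite. -/
structure IsTester {ι : Type*} [Fintype ι] [DecidableEq ι] (c s : ℝ) (P : StateProperty ι)
    (N : ℕ) (T : Matrix (Fin N → ι) (Fin N → ι) ℂ) : Prop where
  nonneg : T.PosSemidef
  le_one : (1 - T).PosSemidef
  complete : ∀ ρ ∈ P.yes, c ≤ (T * tensorPower N ρ).trace.re
  sound : ∀ ρ ∈ P.no, (T * tensorPower N ρ).trace.re ≤ s

/-- The `(c, s)`-sample complexity: the least sample complexity of a `(c, s)`-tester for `P`
(`⊤` if `P` has no `(c, s)`-tester with any number of samples). -/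
noncomputable def sampleComplexity {ι : Type*} [Fintype ι] [DecidableEq ι] (c s : ℝ)
    (P : StateProperty ι) : ℕ∞ :=
  ⨅ (N : ℕ) (_ : ∃ T : Matrix (Fin N → ι) (Fin N → ι) ℂ, IsTester c s P N T), (N : ℕ∞)

/-- The rank-one matrix `|ψ⟩⟨ψ|`. -/
def ketbra {ι : Type*} (ψ : EuclideanSpace ℂ ι) : Matrix ι ι ℂ :=
  Matrix.of fun i j => ψ i * star (ψ j)

/-- The partial trace over the second factor of `ℂ^α ⊗ ℂ^β = ℂ^(α × β)`. -/
def partialTraceB {α β : Type*} [Fintype β] (M : Matrix (α × β) (α × β) ℂ) : Matrix α α ℂ :=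
  Matrix.of fun i j => ∑ k, M (i, k) (j, k)

/-- The bipartite pure states (unit vectors) whose reduced state on the first factor is in `R`. -/
def purifySet {α : Type*} (β : Type*) [Fintype α] [Fintype β] (R : Set (Matrix α α ℂ)) :
    Set (EuclideanSpace ℂ (α × β)) :=
  {ψ | ‖ψ‖ = 1 ∧ partialTraceB (ketbra ψ) ∈ R}

theorem isDensityMatrix_ketbra {ι : Type*} [Fintype ι] (ψ : EuclideanSpace ℂ ι)
    (h : ‖ψ‖ = 1) : IsDensityMatrix (ketbra ψ) := by
  refine ⟨Matrix.posSemidef_vecMulVec_self_star ψ.ofLp, ?_⟩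
  have h2 : ∑ i, ‖ψ i‖ ^ 2 = 1 := by
    rw [← EuclideanSpace.norm_sq_eq, h, one_pow]
  have h3 : (ketbra ψ).trace = ((∑ i, ‖ψ i‖ ^ 2 : ℝ) : ℂ) := by
    simp [Matrix.trace, ketbra, Complex.mul_conj']
  rw [h3, h2, Complex.ofReal_one]

/-- The purified version `Purify(Q)` of a property `Q` of mixed states on `ℂ^α`, with ancilla
space `ℂ^β`. It is a property of bipartite pure states, each `|ψ⟩` being identified with
the state `|ψ⟩⟨ψ|`. -/
def purify {α : Type*} (β : Type*) [Fintype α] [Fintype β] (Q : StateProperty α) :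
    StateProperty (α × β) where
  yes := ketbra '' purifySet β Q.yes
  no := ketbra '' purifySet β Q.no
  yes_density := by
    rintro _ ⟨ψ, hψ, rfl⟩
    exact isDensityMatrix_ketbra ψ hψ.1
  no_density := by
    rintro _ ⟨ψ, hψ, rfl⟩
    exact isDensityMatrix_ketbra ψ hψ.1
  disj := by
    rw [Set.disjoint_left]
    rintro _ ⟨ψ, hψ, rfl⟩ ⟨φ, hφ, h⟩
    have h2 := hφ.2
    rw [h] at h2
    exact Set.disjoint_left.1 Q.disj hψ.2 h2

/-!
A tester for mixed states tests purifications by ignoring the ancillas, so only one inequality is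
substantial: a tester `T` for `purify β Q` has to be turned into a tester for `Q` with as many
samples.

The testers with `N` samples form a closed convex set, stable under conjugation by permutations of
the copies and by `(1 ⊗ U)^{⊗N}` with `U` unitary, since `U` only changes the purification of a
state. The element of least Frobenius norm is unique, hence commutes with all these unitaries
(`exists_mem_commute_of_convex`, `IsTester.exists_permInvariant`); this replaces averaging over Haar
measure. As the unitaries are Zariski dense, the powers `U^{⊗N}` span the permutation-invariant
matrices (`eq_zero_of_tensorPower_unitary`), so `T` commutes with `1 ⊗ Z` for every
permutation-invariant `Z`.

Let `Ω` be the `N`-th power of the unnormalised maximally entangled vector and read `T Ω` as a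
matrix `C` on the first factor (`contractAlong`). For permutation-invariant `S`, the vector `(S ⊗ 1) Ω` can
be written `(1 ⊗ Z) Ω` with `Z` permutation-invariant, and moving `1 ⊗ Z` past `T` gives
`⟨(S ⊗ 1) Ω, T (S ⊗ 1) Ω⟩ = tr (C S Sᴴ)`
(`star_vec_dotProduct_mulVec_eq_trace_contractAlong`). With `S = B^{⊗N}` and `ρ = B Bᴴ`, the left
side is the acceptance probability of a purification of `ρ`, so `C` accepts `ρ` with the same probability.
With `S` an arbitrary permutation-invariant matrix the identity shows `0 ⊑ C`, because `C` is itself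
permutation-invariant (`PermInvariant.posSemidef_of_trace_nonneg`); applied to `1 - T` it shows
`C ⊑ 1`.
-/

open scoped Kronecker

/-! ### Tensor powers and permutation invariance -/

/-- The tensor power `A^{⊗N}` of a rectangular matrix; `tensorPower` is the square case, to which
the lemmas below apply definitionally. -/
def rectTensorPower {α β : Type*} (N : ℕ) (A : Matrix α β ℂ) :
    Matrix (Fin N → α) (Fin N → β) ℂ :=
  Matrix.of fun i j => ∏ k, A (i k) (j k)

theorem rectTensorPower_mul {α β γ : Type*} [Fintype β] (N : ℕ) (A : Matrix α β ℂ)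
    (B : Matrix β γ ℂ) :
    rectTensorPower N (A * B) = rectTensorPower N A * rectTensorPower N B := by
  ext i j
  simp only [rectTensorPower, Matrix.of_apply, Matrix.mul_apply, ← Finset.prod_mul_distrib]
  rw [Finset.prod_univ_sum, Fintype.piFinset_univ]

theorem rectTensorPower_conjTranspose {α β : Type*} (N : ℕ) (A : Matrix α β ℂ) :
    rectTensorPower N A.conjTranspose = (rectTensorPower N A).conjTranspose := by
  ext i j
  simp [rectTensorPower, Matrix.conjTranspose_apply]

theorem tensorPower_mul {ι : Type*} [Fintype ι] (N : ℕ) (A B : Matrix ι ι ℂ) :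
    tensorPower N (A * B) = tensorPower N A * tensorPower N B :=
  rectTensorPower_mul N A B

theorem tensorPower_conjTranspose {ι : Type*} (N : ℕ) (A : Matrix ι ι ℂ) :
    tensorPower N A.conjTranspose = (tensorPower N A).conjTranspose :=
  rectTensorPower_conjTranspose N A

theorem tensorPower_one {ι : Type*} [DecidableEq ι] (N : ℕ) :
    tensorPower N (1 : Matrix ι ι ℂ) = 1 := by
  ext i j
  simp only [tensorPower, Matrix.of_apply, Matrix.one_apply]
  rw [Fintype.prod_ite_zero]
  simp [funext_iff]

theorem tensorPower_mem_unitaryGroup {ι : Type*} [Fintype ι] [DecidableEq ι] (N : ℕ)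
    {U : Matrix ι ι ℂ} (hU : U ∈ Matrix.unitaryGroup ι ℂ) :
    tensorPower N U ∈ Matrix.unitaryGroup (Fin N → ι) ℂ := by
  rw [Matrix.mem_unitaryGroup_iff, Matrix.star_eq_conjTranspose] at *
  rw [← tensorPower_conjTranspose, ← tensorPower_mul, hU, tensorPower_one]

/-- Invariance of a (possibly rectangular) matrix on tensor powers under the simultaneous
permutation of the `N` tensor factors of source and target. -/
def PermInvariant {α β : Type*} {N : ℕ} (M : Matrix (Fin N → α) (Fin N → β) ℂ) : Prop :=
  ∀ (σ : Equiv.Perm (Fin N)) (i : Fin N → α) (j : Fin N → β), M (i ∘ σ) (j ∘ σ) = M i j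

namespace PermInvariant

variable {α β γ : Type*} {N : ℕ}

theorem mul [Fintype β] {A : Matrix (Fin N → α) (Fin N → β) ℂ}
    {B : Matrix (Fin N → β) (Fin N → γ) ℂ} (hA : PermInvariant A) (hB : PermInvariant B) :
    PermInvariant (A * B) := by
  intro σ i j
  simp only [Matrix.mul_apply]
  rw [← (Equiv.arrowCongr σ.symm (Equiv.refl β)).sum_comp]
  exact Finset.sum_congr rfl fun k _ => congrArg₂ _ (hA σ i k) (hB σ k j)

theorem transpose {A : Matrix (Fin N → α) (Fin N → β) ℂ} (hA : PermInvariant A) :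
    PermInvariant A.transpose := fun σ i j => hA σ j i

theorem conjTranspose {A : Matrix (Fin N → α) (Fin N → β) ℂ} (hA : PermInvariant A) :
    PermInvariant A.conjTranspose := fun σ i j => congrArg star (hA σ j i)

end PermInvariant

theorem permInvariant_rectTensorPower {α β : Type*} (N : ℕ) (A : Matrix α β ℂ) :
    PermInvariant (rectTensorPower N A) := fun σ i j =>
  Equiv.prod_comp σ fun k => A (i k) (j k)

/-! ### The span of tensor powers of unitaries -/

theorem exists_perm_of_sum_single_eq {κ : Type*} {N : ℕ} {w w' : Fin N → κ}
    (h : ∑ k, Finsupp.single (w k) 1 = ∑ k, Finsupp.single (w' k) (1 : ℕ)) :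
    ∃ σ : Equiv.Perm (Fin N), w' ∘ σ = w := by
  classical
  have hc : ∀ c, Nonempty ({k // w k = c} ≃ {k // w' k = c}) := by
    intro c
    have := DFunLike.congr_fun h c
    simp only [Finsupp.finsetSum_apply, Finsupp.single_apply, Finset.sum_boole,
      Nat.cast_id] at this
    rw [← Fintype.card_eq, Fintype.card_subtype, Fintype.card_subtype, this]
  let e := fun c => (hc c).some
  exact ⟨Equiv.ofFiberEquiv e, funext fun k => Equiv.ofFiberEquiv_map e k⟩

/-- A vanishing polynomial, written as a sum over words, is annihilated by every coefficient
system that is constant on rearrangements of words. -/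
theorem sum_mul_eq_zero_of_sum_words_eq_zero {κ : Type*} [Fintype κ] {N : ℕ}
    (a z : (Fin N → κ) → ℂ) (hz : ∀ (σ : Equiv.Perm (Fin N)) w, z (w ∘ σ) = z w)
    (h : ∑ w, MvPolynomial.C (a w) * ∏ k, MvPolynomial.X (w k) = (0 : MvPolynomial κ ℂ)) :
    ∑ w, a w * z w = 0 := by
  let s : (Fin N → κ) → κ →₀ ℕ := fun w => ∑ k, Finsupp.single (w k) 1
  have hs : Function.FactorsThrough z s := by
    intro w w' hww
    obtain ⟨σ, rfl⟩ := exists_perm_of_sum_single_eq hww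
    exact hz σ w'
  let L : MvPolynomial κ ℂ →ₗ[ℂ] ℂ :=
    (MvPolynomial.basisMonomials κ ℂ).constr ℂ (Function.extend s z 0)
  have hL : ∀ w, L (MvPolynomial.C (a w) * ∏ k, MvPolynomial.X (w k)) = a w * z w := by
    intro w
    have h1 : (∏ k, MvPolynomial.X (w k) : MvPolynomial κ ℂ) =
        MvPolynomial.basisMonomials κ ℂ (s w) := by
      simp only [MvPolynomial.coe_basisMonomials, s, MvPolynomial.X]
      rw [MvPolynomial.monomial_sum_one]
    rw [h1, MvPolynomial.C_mul', map_smul, Module.Basis.constr_basis, hs.extend_apply, smul_eq_mul]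
  rw [← Finset.sum_congr rfl fun w _ => hL w, ← map_sum, h, map_zero]

/-- The unitary group is Zariski dense in the space of all matrices. -/
theorem MvPolynomial.eq_zero_of_eval_unitary {ι : Type*} [Fintype ι] [DecidableEq ι]
    (p : MvPolynomial (ι × ι) ℂ)
    (h : ∀ U ∈ Matrix.unitaryGroup ι ℂ, MvPolynomial.eval (fun x => U x.1 x.2) p = 0) :
    p = 0 := by
  -- On the matrices diagonalised by a fixed unitary, `p` is a polynomial in the eigenvalues
  -- that vanishes on the torus.
  have herm : ∀ H : Matrix ι ι ℂ, H.IsHermitian →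
      MvPolynomial.eval (fun x => H x.1 x.2) p = 0 := by
    intro H hH
    obtain ⟨V, d, rfl⟩ : ∃ (V : Matrix.unitaryGroup ι ℂ) (d : ι → ℂ),
        H = (V : Matrix ι ι ℂ) * Matrix.diagonal d * star (V : Matrix ι ι ℂ) :=
      ⟨hH.eigenvectorUnitary, _, hH.spectral_theorem⟩
    let q : MvPolynomial ι ℂ := MvPolynomial.bind₁ (fun x : ι × ι =>
      ∑ k, MvPolynomial.C ((V : Matrix ι ι ℂ) x.1 k * star ((V : Matrix ι ι ℂ) x.2 k)) *
        MvPolynomial.X k) p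
    have hq : ∀ y : ι → ℂ, MvPolynomial.eval y q = MvPolynomial.eval
        (fun x => ((V : Matrix ι ι ℂ) * Matrix.diagonal y * star (V : Matrix ι ι ℂ)) x.1 x.2) p := by
      intro y
      simp only [q, MvPolynomial.eval, MvPolynomial.eval₂Hom_bind₁]
      congr 2
      funext x
      simp only [map_sum, map_mul, MvPolynomial.eval₂Hom_C, MvPolynomial.eval₂Hom_X',
        RingHom.id_apply]
      rw [Matrix.mul_apply]
      refine Finset.sum_congr rfl fun k _ => ?_
      rw [Matrix.mul_diagonal, Matrix.star_apply]
      ring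
    have hq0 : q = 0 := by
      refine MvPolynomial.funext_set (fun _ => Metric.sphere (0 : ℂ) 1) (fun _ => ?_) ?_
      · have : Infinite (Set.Ioc (-Real.pi) Real.pi) :=
          Set.infinite_coe_iff.2 (Set.Ioc_infinite (by linarith [Real.pi_pos]))
        have : Infinite Circle := Circle.argEquiv.infinite_iff.2 this
        exact Set.infinite_coe_iff.1 this
      · intro y hy
        rw [hq, map_zero]
        refine h _ ?_
        refine mul_mem (mul_mem V.2 ?_) (Unitary.star_mem V.2)
        rw [Matrix.mem_unitaryGroup_iff, Matrix.star_eq_conjTranspose,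
          Matrix.diagonal_conjTranspose, Matrix.diagonal_mul_diagonal, ← Matrix.diagonal_one]
        congr 1
        funext k
        have := hy k (Set.mem_univ k)
        simp only [mem_sphere_zero_iff_norm] at this
        simp [Complex.mul_conj', this]
    rw [← hq, hq0, map_zero]
  -- Every matrix is `H + I • K` with `H`, `K` Hermitian, and `t ↦ p (H + t • K)` is a polynomial
  -- vanishing on the real line.
  refine MvPolynomial.funext fun m => ?_
  rw [map_zero]
  let M : Matrix ι ι ℂ := Matrix.of fun i j => m (i, j)
  have hdecomp := realPart_add_I_smul_imaginaryPart M
  set H : Matrix ι ι ℂ := (realPart M : Matrix ι ι ℂ) with hH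
  set K : Matrix ι ι ℂ := (imaginaryPart M : Matrix ι ι ℂ) with hK
  have hHh : H.IsHermitian := (realPart M).2
  have hKh : K.IsHermitian := (imaginaryPart M).2
  let q : Polynomial ℂ := MvPolynomial.aeval (fun x : ι × ι =>
    Polynomial.C (H x.1 x.2) + Polynomial.X * Polynomial.C (K x.1 x.2)) p
  have hq : ∀ t : ℂ, q.eval t = MvPolynomial.eval (fun x => (H + t • K) x.1 x.2) p := by
    intro t
    rw [← Polynomial.coe_evalRingHom, MvPolynomial.map_aeval, MvPolynomial.eval]
    congr 2
    · ext x; simp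
    · funext x; simp; ring
  have hq0 : q = 0 := by
    refine Polynomial.eq_zero_of_infinite_isRoot q
      (Set.infinite_of_injective_forall_mem (f := fun t : ℝ => (t : ℂ))
        Complex.ofReal_injective fun t => ?_)
    rw [Set.mem_ofPred_eq, Polynomial.IsRoot, hq]
    refine herm _ (hHh.add ?_)
    rw [Matrix.IsHermitian, Matrix.conjTranspose_smul, hKh]
    simp
  have := hq Complex.I
  rw [hq0, Polynomial.eval_zero, hdecomp] at this
  exact this.symm

/-- The tensor powers of unitaries span all permutation-invariant matrices (stated dually). -/
theorem eq_zero_of_tensorPower_unitary {ι : Type*} [Fintype ι] [DecidableEq ι] {N : ℕ}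
    (φ : Matrix (Fin N → ι) (Fin N → ι) ℂ →ₗ[ℂ] ℂ)
    (h : ∀ U ∈ Matrix.unitaryGroup ι ℂ, φ (tensorPower N U) = 0)
    {Z : Matrix (Fin N → ι) (Fin N → ι) ℂ} (hZ : PermInvariant Z) : φ Z = 0 := by
  let a : (Fin N → ι × ι) → ℂ := fun w =>
    φ (Matrix.single (fun k => (w k).1) (fun k => (w k).2) 1)
  have hφ : ∀ M : Matrix (Fin N → ι) (Fin N → ι) ℂ,
      φ M = ∑ w : Fin N → ι × ι, a w * M (fun k => (w k).1) (fun k => (w k).2) := by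
    intro M
    conv_lhs => rw [Matrix.matrix_eq_sum_single M]
    rw [← Fintype.sum_prod_type' (f := fun i j => Matrix.single i j (M i j)), map_sum,
      ← (Equiv.arrowProdEquivProdArrow (Fin N) (fun _ => ι) (fun _ => ι)).sum_comp]
    refine Finset.sum_congr rfl fun w _ => ?_
    rw [mul_comm, ← smul_eq_mul, ← map_smul, Matrix.smul_single, smul_eq_mul, mul_one]
    rfl
  rw [hφ]
  refine sum_mul_eq_zero_of_sum_words_eq_zero a _
    (fun σ w => hZ σ (fun k => (w k).1) (fun k => (w k).2))
    (MvPolynomial.eq_zero_of_eval_unitary _ fun U hU => ?_)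
  rw [← h U hU, hφ]
  simp [tensorPower]

/-! ### Fixed points of unitary conjugations -/

/-- A nonempty closed convex set of matrices contains a matrix commuting with every unitary
whose conjugation preserves the set: the one of minimal Frobenius norm, which is unique. -/
theorem exists_mem_commute_of_convex {m : Type*} [Fintype m] [DecidableEq m]
    {K : Set (Matrix m m ℂ)} (hne : K.Nonempty) (hcl : IsClosed K) (hcv : Convex ℝ K) :
    ∃ T ∈ K, ∀ U ∈ Matrix.unitaryGroup m ℂ,
      (∀ X ∈ K, U.conjTranspose * X * U ∈ K) → U * T = T * U := by
  let g : EuclideanSpace ℂ (m × m) →ₗ[ℝ] Matrix m m ℂ :=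
    { toFun := fun x => Matrix.of fun i j => x (j, i)
      map_add' := fun x y => rfl
      map_smul' := fun r x => rfl }
  have hg : Continuous g := by
    refine continuous_matrix fun i j => ?_
    change Continuous fun x : EuclideanSpace ℂ (m × m) => x (j, i)
    fun_prop
  have hnorm : ∀ X : Matrix m m ℂ, ((‖WithLp.toLp 2 X.vec‖ ^ 2 : ℝ) : ℂ) =
      (X.conjTranspose * X).trace := by
    intro X
    rw [← Matrix.star_vec_dotProduct_vec, EuclideanSpace.norm_sq_eq]
    simp [dotProduct, Complex.conj_mul']
  obtain ⟨X₀, hX₀⟩ := hne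
  obtain ⟨v, hv, hmin⟩ := (hcl.preimage hg).exists_infDist_eq_dist
    ⟨WithLp.toLp 2 X₀.vec, hX₀⟩ (0 : EuclideanSpace ℂ (m × m))
  have hle : ∀ x ∈ g ⁻¹' K, ‖v‖ ≤ ‖x‖ := by
    intro x hx
    have := Metric.infDist_le_dist_of_mem (x := (0 : EuclideanSpace ℂ (m × m))) hx
    rwa [hmin, dist_zero_left, dist_zero_left] at this
  refine ⟨g v, hv, fun U hU hK => ?_⟩
  let w : EuclideanSpace ℂ (m × m) := WithLp.toLp 2 (U.conjTranspose * g v * U).vec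
  have hUU : U * U.conjTranspose = 1 := by
    rw [← Matrix.star_eq_conjTranspose]; exact Matrix.mem_unitaryGroup_iff.1 hU
  have hw : w ∈ g ⁻¹' K := hK _ hv
  have hwv : ‖w‖ = ‖v‖ := by
    have h1 : v = WithLp.toLp 2 (g v).vec := rfl
    have h2 : ((‖w‖ ^ 2 : ℝ) : ℂ) = ((‖v‖ ^ 2 : ℝ) : ℂ) := by
      have hv2 := hnorm (g v)
      rw [← h1] at hv2
      rw [hnorm, hv2]
      simp only [Matrix.conjTranspose_mul, Matrix.conjTranspose_conjTranspose]
      calc _ = (U.conjTranspose * (g v).conjTranspose * (U * U.conjTranspose) * g v * U).trace := by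
              simp only [Matrix.mul_assoc]
        _ = _ := by
              rw [hUU, Matrix.mul_one, Matrix.trace_mul_comm, ← Matrix.mul_assoc,
                ← Matrix.mul_assoc, hUU, Matrix.one_mul]
    exact (sq_eq_sq₀ (norm_nonneg _) (norm_nonneg _)).1 (Complex.ofReal_injective h2)
  have hwv' : w = v := by
    by_contra hne
    have h1 := norm_combo_lt_of_ne (r := ‖v‖) hwv.le le_rfl hne
      (by norm_num : (0 : ℝ) < 1 / 2) (by norm_num : (0 : ℝ) < 1 / 2) (by norm_num)
    exact absurd (hle _ ((hcv.linear_preimage g) hw hv (by norm_num) (by norm_num) (by norm_num)))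
      (not_le.2 h1)
  have h3 : U.conjTranspose * g v * U = g v := congrArg g hwv'
  calc U * g v = U * (U.conjTranspose * g v * U) := by rw [h3]
    _ = (U * U.conjTranspose) * g v * U := by simp only [Matrix.mul_assoc]
    _ = g v * U := by rw [hUU, Matrix.one_mul]

/-! ### Contraction along a maximally entangled vector -/

section Contraction

variable {a b : Type*} [Fintype a] [Fintype b]

/-- Identifying `ℂ^a ⊗ ℂ^b` with `b × a` matrices, `T` maps the (unnormalised) maximally entangled
vector `E` to some matrix `Y`; the contraction of `T` along `E` is `(Eᴴ Y)ᵀ`. -/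
def contractAlong (E : Matrix b a ℂ) (T : Matrix (a × b) (a × b) ℂ) : Matrix a a ℂ :=
  (E.conjTranspose * Matrix.of fun j i => (T.mulVec E.vec) (i, j)).transpose

theorem contractAlong_one_sub [DecidableEq a] [DecidableEq b] {E : Matrix b a ℂ}
    (hE : E.conjTranspose * E = 1) (T : Matrix (a × b) (a × b) ℂ) :
    contractAlong E (1 - T) = 1 - contractAlong E T := by
  have : (Matrix.of fun j i => ((1 - T).mulVec E.vec) (i, j)) =
      E - Matrix.of fun j i => (T.mulVec E.vec) (i, j) := by
    ext j i
    simp [Matrix.sub_mulVec, Matrix.vec]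
  rw [contractAlong, this, Matrix.mul_sub, hE, Matrix.transpose_sub, Matrix.transpose_one]
  rfl

/-- The vector `(S ⊗ 1) E` equals `(1 ⊗ E Sᵀ Eᴴ) E`, so an operator commuting with
`1 ⊗ E Sᵀ Eᴴ` has the same quadratic form on it as its contraction has against `S Sᴴ`. -/
theorem star_vec_dotProduct_mulVec_eq_trace_contractAlong [DecidableEq a] {E : Matrix b a ℂ}
    (hE : E.conjTranspose * E = 1) (T : Matrix (a × b) (a × b) ℂ) (S : Matrix a a ℂ)
    (hcomm : T * ((1 : Matrix a a ℂ) ⊗ₖ (E * S.transpose * E.conjTranspose)) =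
      ((1 : Matrix a a ℂ) ⊗ₖ (E * S.transpose * E.conjTranspose)) * T) :
    dotProduct (star (E * S.transpose).vec) (T.mulVec (E * S.transpose).vec) =
      (contractAlong E T * (S * S.conjTranspose)).trace := by
  set Y : Matrix b a ℂ := Matrix.of fun j i => (T.mulVec E.vec) (i, j) with hY
  have hYv : T.mulVec E.vec = Y.vec := rfl
  have h1 : (E * S.transpose).vec =
      ((1 : Matrix a a ℂ) ⊗ₖ (E * S.transpose * E.conjTranspose)).mulVec E.vec := by
    rw [Matrix.kronecker_mulVec_vec, Matrix.transpose_one, Matrix.mul_one, Matrix.mul_assoc, hE,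
      Matrix.mul_one]
  have h2 : T.mulVec (E * S.transpose).vec = (E * S.transpose * E.conjTranspose * Y).vec := by
    rw [h1, Matrix.mulVec_mulVec, hcomm, ← Matrix.mulVec_mulVec, hYv,
      Matrix.kronecker_mulVec_vec, Matrix.transpose_one, Matrix.mul_one]
  rw [h2, Matrix.star_vec_dotProduct_vec, contractAlong, ← hY, ← Matrix.trace_transpose,
    Matrix.conjTranspose_mul]
  have h3 : S.transpose.conjTranspose * E.conjTranspose *
        (E * S.transpose * E.conjTranspose * Y) =
      S.transpose.conjTranspose * (E.conjTranspose * E) * S.transpose *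
        (E.conjTranspose * Y) := by
    simp only [Matrix.mul_assoc]
  have h4 : (S.transpose.conjTranspose * S.transpose).transpose = S * S.conjTranspose := by
    rw [Matrix.transpose_mul]
    rfl
  rw [h3, hE, Matrix.mul_one, Matrix.transpose_mul, h4]

end Contraction

/-! ### Positivity of permutation-invariant matrices -/

/-- The trace pairing with permutation-invariant positive matrices detects positivity of
permutation-invariant matrices: average a rank-one projection over permutations, and use that the
positive square root of a permutation-invariant matrix is again permutation-invariant. -/
theorem PermInvariant.posSemidef_of_trace_nonneg {α : Type*} [Fintype α] [DecidableEq α] {N : ℕ}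
    {M : Matrix (Fin N → α) (Fin N → α) ℂ} (hM : PermInvariant M)
    (h : ∀ S : Matrix (Fin N → α) (Fin N → α) ℂ, PermInvariant S →
      0 ≤ (M * (S * S.conjTranspose)).trace) : M.PosSemidef := by
  have form : ∀ x : (Fin N → α) → ℂ, 0 ≤ dotProduct (star x) (M.mulVec x) := by
    intro x
    let W := Matrix.vecMulVec x (star x)
    let e : Equiv.Perm (Fin N) → Equiv.Perm (Fin N → α) := fun σ =>
      Equiv.arrowCongr σ.symm (Equiv.refl α)
    have he : ∀ σ w, e σ w = w ∘ σ := fun σ w => rfl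
    let A := ∑ σ : Equiv.Perm (Fin N), W.submatrix (e σ) (e σ)
    have hW : W.PosSemidef := Matrix.posSemidef_vecMulVec_self_star x
    have hA : A.PosSemidef := Matrix.posSemidef_sum _ fun σ _ => hW.submatrix _
    have hAinv : PermInvariant A := by
      intro τ i j
      simp only [A, Matrix.sum_apply, Matrix.submatrix_apply, he]
      exact Equiv.sum_comp (Equiv.mulLeft τ) fun σ => W (i ∘ σ) (j ∘ σ)
    obtain ⟨S, hS, hSinv, hSA⟩ : ∃ S : Matrix (Fin N → α) (Fin N → α) ℂ,
        S.PosSemidef ∧ PermInvariant S ∧ S * S = A := by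
      open scoped MatrixOrder in
      have hA0 : 0 ≤ A := hA.nonneg
      refine ⟨CFC.sqrt A, (Matrix.nonneg_iff_posSemidef.1 (CFC.sqrt_nonneg A)), fun σ i j => ?_,
        CFC.sqrt_mul_sqrt_self A hA0⟩
      have hp : ((CFC.sqrt A).submatrix (e σ) (e σ)).PosSemidef :=
        (Matrix.nonneg_iff_posSemidef.1 (CFC.sqrt_nonneg A)).submatrix _
      have hu := CFC.sqrt_unique (a := A) (b := (CFC.sqrt A).submatrix (e σ) (e σ)) (by
        rw [Matrix.submatrix_mul_equiv, CFC.sqrt_mul_sqrt_self A hA0]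
        ext i j
        exact hAinv σ i j) hp.nonneg
      exact (congrFun (congrFun hu i) j).symm
    have h0 := h S hSinv
    rw [hS.isHermitian.eq, hSA, Matrix.mul_sum, Matrix.trace_sum] at h0
    have hterm : ∀ σ, (M * W.submatrix (e σ) (e σ)).trace = dotProduct (star x) (M.mulVec x) := by
      intro σ
      have hMσ : M = M.submatrix (e σ) (e σ) := by
        ext i j
        exact (hM σ i j).symm
      conv_lhs => rw [hMσ]
      rw [Matrix.submatrix_mul_equiv]
      exact (Equiv.sum_comp (e σ) fun i => (M * W) i i).trans (by
        change (M * W).trace = _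
        rw [Matrix.mul_vecMulVec, Matrix.trace_vecMulVec, dotProduct_comm])
    rw [Finset.sum_congr rfl fun σ _ => hterm σ, Finset.sum_const, Finset.card_univ,
      nsmul_eq_mul] at h0
    have hcard : (0 : ℂ) < (Fintype.card (Equiv.Perm (Fin N)) : ℂ) := by
      exact_mod_cast Fintype.card_pos
    exact le_of_mul_le_mul_left (by rwa [mul_zero]) hcard
  rw [← Matrix.isPositive_toEuclideanLin_iff, LinearMap.isPositive_iff_complex]
  intro x
  obtain ⟨hre, him⟩ := Complex.nonneg_iff.1 (form x.ofLp)
  have h2 : inner ℂ (M.toEuclideanLin x) x = star (dotProduct (star x.ofLp) (M.mulVec x.ofLp)) := by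
    rw [← inner_conj_symm, EuclideanSpace.inner_eq_star_dotProduct, dotProduct_comm]
    rfl
  rw [h2]
  refine ⟨Complex.ext rfl ?_, hre⟩
  simp [← him]

/-! ### Purifications -/

theorem trace_mul_tensorPower_ketbra {ι : Type*} [Fintype ι] {N : ℕ}
    (T : Matrix (Fin N → ι) (Fin N → ι) ℂ) (ψ : EuclideanSpace ℂ ι) :
    (T * tensorPower N (ketbra ψ)).trace =
      dotProduct (star fun w : Fin N → ι => ∏ k, ψ (w k))
        (T.mulVec fun w : Fin N → ι => ∏ k, ψ (w k)) := by
  have h : tensorPower N (ketbra ψ) = Matrix.vecMulVec (fun w : Fin N → ι => ∏ k, ψ (w k))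
      (star fun w : Fin N → ι => ∏ k, ψ (w k)) := by
    ext i j
    simp [tensorPower, ketbra, Matrix.vecMulVec_apply, Finset.prod_mul_distrib]
  rw [h, Matrix.mul_vecMulVec, Matrix.trace_vecMulVec, dotProduct_comm]

/-- A bipartite vector with coefficient matrix `X` has reduced state `Xᵀ (Xᵀ)ᴴ`. -/
theorem partialTraceB_ketbra_vec {α β : Type*} [Fintype β] (X : Matrix β α ℂ) :
    partialTraceB (ketbra (WithLp.toLp 2 X.vec)) = X.transpose * X.transpose.conjTranspose := by
  ext i j
  simp [partialTraceB, ketbra, Matrix.vec, Matrix.mul_apply]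

theorem mem_purifySet_iff {α β : Type*} [Fintype α] [Fintype β] {R : Set (Matrix α α ℂ)}
    (hR : ∀ ρ ∈ R, IsDensityMatrix ρ) (ψ : EuclideanSpace ℂ (α × β)) :
    ψ ∈ purifySet β R ↔ partialTraceB (ketbra ψ) ∈ R := by
  refine ⟨fun h => h.2, fun h => ⟨?_, h⟩⟩
  have h1 : (((‖ψ‖ ^ 2 : ℝ)) : ℂ) = (partialTraceB (ketbra ψ)).trace := by
    rw [EuclideanSpace.norm_sq_eq, Fintype.sum_prod_type]
    simp [Matrix.trace, partialTraceB, ketbra, Complex.mul_conj']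
  rw [(hR _ h).2] at h1
  have h2 : ‖ψ‖ ^ 2 = 1 := by exact_mod_cast h1
  exact (pow_eq_one_iff_of_nonneg (norm_nonneg ψ) two_ne_zero).1 h2

theorem ketbra_mulVec {ι : Type*} [Fintype ι] (A : Matrix ι ι ℂ) (v : ι → ℂ) :
    ketbra (WithLp.toLp 2 (A.mulVec v)) =
      A * ketbra (WithLp.toLp 2 v) * A.conjTranspose := by
  have h : ∀ v : ι → ℂ, ketbra (WithLp.toLp 2 v) = Matrix.vecMulVec v (star v) := fun v => rfl
  rw [h, h, Matrix.mul_vecMulVec, Matrix.vecMulVec_mul, Matrix.star_mulVec]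

/-- A unitary on the ancilla maps purifications to purifications of the same state. -/
theorem exists_ketbra_eq_conj_of_unitary {α β : Type*} [Fintype α] [Fintype β] [DecidableEq α]
    [DecidableEq β] {R : Set (Matrix α α ℂ)} (hR : ∀ ρ ∈ R, IsDensityMatrix ρ) {U : Matrix β β ℂ}
    (hU : U ∈ Matrix.unitaryGroup β ℂ) {ρ : Matrix (α × β) (α × β) ℂ}
    (hρ : ρ ∈ ketbra '' purifySet β R) :
    ((1 : Matrix α α ℂ) ⊗ₖ U) * ρ * ((1 : Matrix α α ℂ) ⊗ₖ U).conjTranspose ∈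
      ketbra '' purifySet β R := by
  obtain ⟨ψ, hψ, rfl⟩ := hρ
  let X : Matrix β α ℂ := Matrix.of fun j i => ψ (i, j)
  have hX : ψ = WithLp.toLp 2 X.vec := rfl
  rw [mem_purifySet_iff hR, hX, partialTraceB_ketbra_vec] at hψ
  refine ⟨WithLp.toLp 2 (U * X).vec, (mem_purifySet_iff hR _).2 ?_, ?_⟩
  · rw [partialTraceB_ketbra_vec]
    convert hψ using 1
    have hU' : U.transpose * U.transpose.conjTranspose = 1 := by
      have := congrArg Matrix.transpose (Matrix.mem_unitaryGroup_iff'.1 hU)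
      rwa [Matrix.star_eq_conjTranspose, Matrix.transpose_mul, Matrix.transpose_one] at this
    rw [Matrix.transpose_mul, Matrix.conjTranspose_mul, Matrix.mul_assoc,
      ← Matrix.mul_assoc U.transpose, hU', Matrix.one_mul]
  · have : (U * X).vec = ((1 : Matrix α α ℂ) ⊗ₖ U).mulVec X.vec := by
      rw [Matrix.kronecker_mulVec_vec, Matrix.transpose_one, Matrix.mul_one]
    rw [this, ketbra_mulVec, hX]

/-! ### The convex set of testers -/

namespace IsTester

variable {ι : Type*} [Fintype ι] [DecidableEq ι] {c s : ℝ} {P : StateProperty ι} {N : ℕ}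

theorem conj {T U : Matrix (Fin N → ι) (Fin N → ι) ℂ} (hT : IsTester c s P N T)
    (hU : U ∈ Matrix.unitaryGroup (Fin N → ι) ℂ)
    (hyes : ∀ ρ ∈ P.yes, ∃ ρ' ∈ P.yes, U * tensorPower N ρ * U.conjTranspose = tensorPower N ρ')
    (hno : ∀ ρ ∈ P.no, ∃ ρ' ∈ P.no, U * tensorPower N ρ * U.conjTranspose = tensorPower N ρ') :
    IsTester c s P N (U.conjTranspose * T * U) := by
  have hUU : U.conjTranspose * U = 1 := by
    rw [← Matrix.star_eq_conjTranspose]; exact Matrix.mem_unitaryGroup_iff'.1 hU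
  have htr : ∀ R, (U.conjTranspose * T * U * R).trace = (T * (U * R * U.conjTranspose)).trace := by
    intro R
    rw [Matrix.mul_assoc, Matrix.mul_assoc, Matrix.trace_mul_comm, Matrix.mul_assoc]
  refine ⟨hT.nonneg.conjTranspose_mul_mul_same U, ?_, fun ρ hρ => ?_, fun ρ hρ => ?_⟩
  · have := hT.le_one.conjTranspose_mul_mul_same U
    rwa [Matrix.mul_sub, Matrix.mul_one, Matrix.sub_mul, hUU] at this
  · obtain ⟨ρ', h', he⟩ := hyes ρ hρ
    rw [htr, he]
    exact hT.complete ρ' h'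
  · obtain ⟨ρ', h', he⟩ := hno ρ hρ
    rw [htr, he]
    exact hT.sound ρ' h'

end IsTester

theorem isClosed_posSemidef {m : Type*} [Fintype m] :
    IsClosed {T : Matrix m m ℂ | T.PosSemidef} := by
  have : {T : Matrix m m ℂ | T.PosSemidef} = {T : Matrix m m ℂ | T.conjTranspose = T} ∩
      ⋂ x : m → ℂ, {T | 0 ≤ dotProduct (star x) (T.mulVec x)} := by
    ext T
    simp [Matrix.posSemidef_iff_dotProduct_mulVec, Matrix.IsHermitian]
  rw [this]
  refine (isClosed_eq (by fun_prop) continuous_id).inter (isClosed_iInter fun x => ?_)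
  have hc : Continuous fun T : Matrix m m ℂ => dotProduct (star x) (T.mulVec x) := by fun_prop
  simp only [Complex.nonneg_iff, Set.ofPred_and]
  exact (isClosed_le continuous_const (Complex.continuous_re.comp hc)).inter
    (isClosed_eq continuous_const (Complex.continuous_im.comp hc))

theorem isClosed_setOf_isTester {ι : Type*} [Fintype ι] [DecidableEq ι] (c s : ℝ)
    (P : StateProperty ι) (N : ℕ) :
    IsClosed {T : Matrix (Fin N → ι) (Fin N → ι) ℂ | IsTester c s P N T} := by
  have hc : ∀ ρ, Continuous fun T : Matrix (Fin N → ι) (Fin N → ι) ℂ =>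
      (T * tensorPower N ρ).trace.re := fun ρ => by
    refine Complex.continuous_re.comp ?_
    fun_prop
  have : {T : Matrix (Fin N → ι) (Fin N → ι) ℂ | IsTester c s P N T} =
      ({T | T.PosSemidef} ∩ (fun T => 1 - T) ⁻¹' {T | T.PosSemidef}) ∩
      ((⋂ ρ ∈ P.yes, {T | c ≤ (T * tensorPower N ρ).trace.re}) ∩
      ⋂ ρ ∈ P.no, {T | (T * tensorPower N ρ).trace.re ≤ s}) := by
    ext T
    simp only [Set.mem_inter_iff, Set.mem_iInter]
    exact ⟨fun h => ⟨⟨h.1, h.2⟩, h.3, h.4⟩, fun h => ⟨h.1.1, h.1.2, h.2.1, h.2.2⟩⟩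
  rw [this]
  exact (isClosed_posSemidef.inter (isClosed_posSemidef.preimage (by fun_prop))).inter
    ((isClosed_biInter fun ρ _ => isClosed_le continuous_const (hc ρ)).inter
      (isClosed_biInter fun ρ _ => isClosed_le (hc ρ) continuous_const))

theorem convex_setOf_isTester {ι : Type*} [Fintype ι] [DecidableEq ι] (c s : ℝ)
    (P : StateProperty ι) (N : ℕ) :
    Convex ℝ {T : Matrix (Fin N → ι) (Fin N → ι) ℂ | IsTester c s P N T} := by
  intro T hT T' hT' a b ha hb hab
  have hlin : ∀ ρ, ((a • T + b • T') * tensorPower N ρ).trace.re =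
      a * (T * tensorPower N ρ).trace.re + b * (T' * tensorPower N ρ).trace.re := by
    intro ρ
    simp [Matrix.add_mul, Matrix.trace_add, Matrix.trace_smul]
  refine ⟨(hT.nonneg.smul ha).add (hT'.nonneg.smul hb), ?_, fun ρ hρ => ?_, fun ρ hρ => ?_⟩
  · have h1 : (1 : Matrix (Fin N → ι) (Fin N → ι) ℂ) - (a • T + b • T') =
        a • (1 - T) + b • (1 - T') := by
      have : (1 : Matrix (Fin N → ι) (Fin N → ι) ℂ) = a • 1 + b • 1 := by
        rw [← add_smul, hab, one_smul]
      conv_lhs => rw [this]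
      rw [smul_sub, smul_sub]
      abel
    rw [h1]
    exact (hT.le_one.smul ha).add (hT'.le_one.smul hb)
  · rw [hlin]
    exact convex_Ici c (hT.complete ρ hρ) (hT'.complete ρ hρ) ha hb hab
  · rw [hlin]
    exact convex_Iic s (hT.sound ρ hρ) (hT'.sound ρ hρ) ha hb hab

/-! ### Symmetrised testers -/

/-- A matrix commuting with the ancilla unitaries `(1 ⊗ U)^{⊗N}` commutes with `1 ⊗ Z` for every
permutation-invariant `Z`. The equivalence regroups the tensor factors. -/
theorem commute_one_kronecker_of_permInvariant {α β : Type*} [Fintype α] [Fintype β]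
    [DecidableEq α] [DecidableEq β] {N : ℕ}
    (T : Matrix (Fin N → α × β) (Fin N → α × β) ℂ)
    (hT : ∀ U ∈ Matrix.unitaryGroup β ℂ, tensorPower N ((1 : Matrix α α ℂ) ⊗ₖ U) * T =
      T * tensorPower N ((1 : Matrix α α ℂ) ⊗ₖ U))
    {Z : Matrix (Fin N → β) (Fin N → β) ℂ} (hZ : PermInvariant Z) :
    let e := (Equiv.arrowProdEquivProdArrow (Fin N) (fun _ => α) (fun _ => β)).symm
    T.submatrix e e * ((1 : Matrix (Fin N → α) (Fin N → α) ℂ) ⊗ₖ Z) =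
      ((1 : Matrix (Fin N → α) (Fin N → α) ℂ) ⊗ₖ Z) * T.submatrix e e := by
  intro e
  ext x y
  let k : Matrix (Fin N → β) (Fin N → β) ℂ →ₗ[ℂ]
      Matrix ((Fin N → α) × (Fin N → β)) ((Fin N → α) × (Fin N → β)) ℂ :=
    Matrix.kroneckerBilinear (R := ℂ) 1
  let φ : Matrix (Fin N → β) (Fin N → β) ℂ →ₗ[ℂ] ℂ :=
    Matrix.entryLinearMap ℂ ℂ x y ∘ₗ
      (LinearMap.mulLeft ℂ (T.submatrix e e) - LinearMap.mulRight ℂ (T.submatrix e e)) ∘ₗ k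
  have hφ : ∀ Z, φ Z = (T.submatrix e e * ((1 : Matrix (Fin N → α) (Fin N → α) ℂ) ⊗ₖ Z)) x y -
      (((1 : Matrix (Fin N → α) (Fin N → α) ℂ) ⊗ₖ Z) * T.submatrix e e) x y := fun Z => rfl
  refine sub_eq_zero.1 ((hφ Z).symm.trans (eq_zero_of_tensorPower_unitary φ (fun U hU => ?_) hZ))
  have hk : (1 : Matrix (Fin N → α) (Fin N → α) ℂ) ⊗ₖ tensorPower N U =
      (tensorPower N ((1 : Matrix α α ℂ) ⊗ₖ U)).submatrix e e := by
    rw [← tensorPower_one]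
    ext p q
    simp only [tensorPower, Matrix.kroneckerMap_apply, Matrix.submatrix_apply, Matrix.of_apply,
      ← Finset.prod_mul_distrib]
    rfl
  rw [hφ, hk, Matrix.submatrix_mul_equiv, Matrix.submatrix_mul_equiv, hT U hU, sub_self]

/-- A tester may be chosen to commute with every unitary under which both sides of the property
are, on the level of `N` copies, invariant. -/
theorem IsTester.exists_commute {ι : Type*} [Fintype ι] [DecidableEq ι] {c s : ℝ}
    {P : StateProperty ι} {N : ℕ} {T₀ : Matrix (Fin N → ι) (Fin N → ι) ℂ}
    (hT₀ : IsTester c s P N T₀) :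
    ∃ T, IsTester c s P N T ∧ ∀ U ∈ Matrix.unitaryGroup (Fin N → ι) ℂ,
      (∀ ρ ∈ P.yes, ∃ ρ' ∈ P.yes,
        U * tensorPower N ρ * U.conjTranspose = tensorPower N ρ') →
      (∀ ρ ∈ P.no, ∃ ρ' ∈ P.no,
        U * tensorPower N ρ * U.conjTranspose = tensorPower N ρ') → U * T = T * U := by
  obtain ⟨T, hT, h⟩ := exists_mem_commute_of_convex ⟨T₀, hT₀⟩ (isClosed_setOf_isTester c s P N)
    (convex_setOf_isTester c s P N)
  exact ⟨T, hT, fun U hU hy hn => h U hU fun X hX => IsTester.conj hX hU hy hn⟩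

/-- A tester for the purified property may be chosen invariant under permutations of the copies and
under a common unitary on all ancillas. -/
theorem IsTester.exists_permInvariant {α β : Type*} [Fintype α] [Fintype β] [DecidableEq α]
    [DecidableEq β] {c s : ℝ} {Q : StateProperty α} {N : ℕ}
    {T₀ : Matrix (Fin N → α × β) (Fin N → α × β) ℂ} (hT₀ : IsTester c s (purify β Q) N T₀) :
    ∃ T, IsTester c s (purify β Q) N T ∧ PermInvariant T ∧
      ∀ U ∈ Matrix.unitaryGroup β ℂ, tensorPower N ((1 : Matrix α α ℂ) ⊗ₖ U) * T =
        T * tensorPower N ((1 : Matrix α α ℂ) ⊗ₖ U) := by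
  obtain ⟨T, hT, hcomm⟩ := hT₀.exists_commute
  refine ⟨T, hT, fun σ => ?_, fun U hU => ?_⟩
  · let e : (Fin N → α × β) ≃ (Fin N → α × β) := Equiv.arrowCongr σ.symm (Equiv.refl _)
    let V : Matrix (Fin N → α × β) (Fin N → α × β) ℂ := (1 : Matrix _ _ ℂ).submatrix e id
    have hV : ∀ X : Matrix (Fin N → α × β) (Fin N → α × β) ℂ, V * X = X.submatrix e id := by
      intro X
      ext i j
      simp [V, Matrix.mul_apply, Matrix.one_apply]
    have hV' : V.conjTranspose = (1 : Matrix _ _ ℂ).submatrix id e := by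
      simp [V, Matrix.conjTranspose_submatrix]
    have hX : ∀ X : Matrix (Fin N → α × β) (Fin N → α × β) ℂ,
        X * V.conjTranspose = X.submatrix id e := by
      intro X
      rw [hV']
      ext i j
      simp [Matrix.mul_apply, Matrix.one_apply]
    have hVu : V ∈ Matrix.unitaryGroup (Fin N → α × β) ℂ := by
      rw [Matrix.mem_unitaryGroup_iff, Matrix.star_eq_conjTranspose, hX, Matrix.submatrix_submatrix]
      simp
    have hconj : ∀ ρ : Matrix (α × β) (α × β) ℂ,
        V * tensorPower N ρ * V.conjTranspose = tensorPower N ρ := by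
      intro ρ
      rw [hV, hX]
      ext i j
      exact permInvariant_rectTensorPower N ρ σ i j
    have hVT := hcomm V hVu (fun ρ hρ => ⟨ρ, hρ, hconj ρ⟩) (fun ρ hρ => ⟨ρ, hρ, hconj ρ⟩)
    have hVTV : V * T * V.conjTranspose = T := by
      rw [hVT, Matrix.mul_assoc, ← Matrix.star_eq_conjTranspose,
        Matrix.mem_unitaryGroup_iff.1 hVu, Matrix.mul_one]
    rw [hV, hX] at hVTV
    exact fun i j => congrFun (congrFun hVTV i) j
  · have h1 : (1 : Matrix α α ℂ) ⊗ₖ U ∈ Matrix.unitaryGroup (α × β) ℂ :=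
      Matrix.kronecker_mem_unitary (one_mem _) hU
    have h2 : ∀ ρ, tensorPower N ((1 : Matrix α α ℂ) ⊗ₖ U) * tensorPower N ρ *
          (tensorPower N ((1 : Matrix α α ℂ) ⊗ₖ U)).conjTranspose =
        tensorPower N (((1 : Matrix α α ℂ) ⊗ₖ U) * ρ * ((1 : Matrix α α ℂ) ⊗ₖ U).conjTranspose) := by
      intro ρ
      rw [← tensorPower_conjTranspose, ← tensorPower_mul, ← tensorPower_mul]
    exact hcomm _ (tensorPower_mem_unitaryGroup N h1)
      (fun ρ hρ => ⟨_, exists_ketbra_eq_conj_of_unitary Q.yes_density hU hρ, h2 ρ⟩)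
      (fun ρ hρ => ⟨_, exists_ketbra_eq_conj_of_unitary Q.no_density hU hρ, h2 ρ⟩)

/-! ### Passing between testers for states and for purifications -/

/-- A tester for the purified property yields a tester for the mixed states: contract a symmetrised
tester along the `N`-th power of a maximally entangled vector. The isometry `E` of `ℂ^α` into
the ancilla, read as a bipartite vector, is that vector. -/
theorem IsTester.exists_of_purify {α β : Type*} [Fintype α] [Fintype β] [DecidableEq α]
    [DecidableEq β] {E : Matrix β α ℂ} (hE : E.conjTranspose * E = 1) {c s : ℝ}
    {Q : StateProperty α} {N : ℕ} {T₀ : Matrix (Fin N → α × β) (Fin N → α × β) ℂ}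
    (hT₀ : IsTester c s (purify β Q) N T₀) : ∃ T, IsTester c s Q N T := by
  obtain ⟨T, hT, hTinv, hTU⟩ := hT₀.exists_permInvariant
  let e := (Equiv.arrowProdEquivProdArrow (Fin N) (fun _ => α) (fun _ => β)).symm
  let F := rectTensorPower N E
  have hF : F.conjTranspose * F = 1 := by
    rw [← rectTensorPower_conjTranspose, ← rectTensorPower_mul, hE]
    exact tensorPower_one N
  have hFinv : PermInvariant F := permInvariant_rectTensorPower N E
  have hform : ∀ S : Matrix (Fin N → α) (Fin N → α) ℂ, PermInvariant S →
      dotProduct (star (F * S.transpose).vec) ((T.submatrix e e).mulVec (F * S.transpose).vec) =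
        (contractAlong F (T.submatrix e e) * (S * S.conjTranspose)).trace := fun S hS =>
    star_vec_dotProduct_mulVec_eq_trace_contractAlong hF _ S
      (commute_one_kronecker_of_permInvariant T hTU
        ((hFinv.mul hS.transpose).mul hFinv.conjTranspose))
  have hform' : ∀ S : Matrix (Fin N → α) (Fin N → α) ℂ, PermInvariant S →
      dotProduct (star (F * S.transpose).vec)
          ((1 - T.submatrix e e).mulVec (F * S.transpose).vec) =
        (contractAlong F (1 - T.submatrix e e) * (S * S.conjTranspose)).trace := fun S hS =>
    star_vec_dotProduct_mulVec_eq_trace_contractAlong hF _ S (by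
      rw [Matrix.sub_mul, Matrix.mul_sub, Matrix.one_mul, Matrix.mul_one,
        commute_one_kronecker_of_permInvariant T hTU
          ((hFinv.mul hS.transpose).mul hFinv.conjTranspose)])
  have hCinv : PermInvariant (contractAlong F (T.submatrix e e)) := by
    refine (hFinv.conjTranspose.mul fun σ j i => ?_).transpose
    simp only [Matrix.of_apply, Matrix.mulVec, dotProduct]
    let p : Equiv.Perm ((Fin N → α) × (Fin N → β)) :=
      Equiv.prodCongr (Equiv.arrowCongr σ.symm (Equiv.refl α))
        (Equiv.arrowCongr σ.symm (Equiv.refl β))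
    rw [← Equiv.sum_comp p]
    exact Finset.sum_congr rfl fun x _ =>
      congrArg₂ (· * ·) (hTinv σ (e (i, j)) (e x)) (hFinv σ x.2 x.1)
  have hpos : (contractAlong F (T.submatrix e e)).PosSemidef :=
    hCinv.posSemidef_of_trace_nonneg fun S hS => by
      rw [← hform S hS]
      exact (hT.nonneg.submatrix e).dotProduct_mulVec_nonneg _
  have hle : (1 - contractAlong F (T.submatrix e e)).PosSemidef := by
    have hinv : PermInvariant (1 - contractAlong F (T.submatrix e e)) := by
      intro σ i j
      have h1 := hCinv σ i j
      have h2 : (1 : Matrix (Fin N → α) (Fin N → α) ℂ) (i ∘ σ) (j ∘ σ) =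
          (1 : Matrix (Fin N → α) (Fin N → α) ℂ) i j := by
        rw [← tensorPower_one]
        exact permInvariant_rectTensorPower N _ σ i j
      rw [Matrix.sub_apply, Matrix.sub_apply, h1, h2]
    refine hinv.posSemidef_of_trace_nonneg fun S hS => ?_
    rw [← contractAlong_one_sub hF, ← hform' S hS]
    have := hT.le_one.submatrix e
    rw [Matrix.submatrix_sub, Pi.sub_apply, Pi.sub_apply, Matrix.submatrix_one_equiv] at this
    exact this.dotProduct_mulVec_nonneg _
  have hsub : ∀ v : (Fin N → α × β) → ℂ,
      dotProduct (star (v ∘ e)) ((T.submatrix e e).mulVec (v ∘ e)) =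
        dotProduct (star v) (T.mulVec v) := by
    intro v
    have h1 : (v ∘ e) ∘ e.symm = v := by
      rw [Function.comp_assoc, Equiv.self_comp_symm, Function.comp_id]
    rw [Matrix.submatrix_mulVec_equiv, h1]
    exact comp_equiv_dotProduct_comp_equiv (star v) (T.mulVec v) e
  -- The contraction accepts `ρ` exactly as `T` accepts the purification of `ρ` built from `E`.
  have key : ∀ R : Set (Matrix α α ℂ), (∀ ρ ∈ R, IsDensityMatrix ρ) → ∀ ρ ∈ R,
      ∃ ρ' ∈ ketbra '' purifySet β R, (contractAlong F (T.submatrix e e) * tensorPower N ρ).trace =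
        (T * tensorPower N ρ').trace := by
    intro R hR ρ hρ
    obtain ⟨B, hB⟩ : ∃ B : Matrix α α ℂ, ρ = B * B.conjTranspose := by
      open scoped MatrixOrder in
      exact CStarAlgebra.nonneg_iff_eq_mul_star_self.1 (hR ρ hρ).1.nonneg
    refine ⟨_, ⟨WithLp.toLp 2 (E * B.transpose).vec, (mem_purifySet_iff hR _).2 ?_, rfl⟩, ?_⟩
    · rw [partialTraceB_ketbra_vec]
      convert hρ using 1
      have hE' : E.transpose * E.transpose.conjTranspose = 1 := by
        have := congrArg Matrix.transpose hE
        rwa [Matrix.transpose_mul, Matrix.transpose_one] at this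
      rw [Matrix.transpose_mul, Matrix.transpose_transpose, Matrix.conjTranspose_mul,
        Matrix.mul_assoc, ← Matrix.mul_assoc E.transpose, hE', Matrix.one_mul, hB]
    · rw [trace_mul_tensorPower_ketbra, hB, tensorPower_mul, tensorPower_conjTranspose,
        ← hform (tensorPower N B) (permInvariant_rectTensorPower N B)]
      have hv : (F * (tensorPower N B).transpose).vec =
          (fun w : Fin N → α × β => ∏ k, (E * B.transpose).vec (w k)) ∘ e := by
        have : F * (tensorPower N B).transpose = rectTensorPower N (E * B.transpose) :=
          (rectTensorPower_mul N E B.transpose).symm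
        rw [this]
        rfl
      rw [hv, hsub]
  refine ⟨_, hpos, hle, fun ρ hρ => ?_, fun ρ hρ => ?_⟩
  · obtain ⟨ρ', h', he⟩ := key _ Q.yes_density ρ hρ
    rw [he]
    exact hT.complete ρ' h'
  · obtain ⟨ρ', h', he⟩ := key _ Q.no_density ρ hρ
    rw [he]
    exact hT.sound ρ' h'

/-- A tester for mixed states, applied to the first halves of the copies, tests purifications. -/
theorem IsTester.exists_purify {α β : Type*} [Fintype α] [Fintype β] [DecidableEq α]
    [DecidableEq β] {c s : ℝ} {Q : StateProperty α} {N : ℕ}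
    {T : Matrix (Fin N → α) (Fin N → α) ℂ} (hT : IsTester c s Q N T) :
    ∃ T', IsTester c s (purify β Q) N T' := by
  let e := Equiv.arrowProdEquivProdArrow (Fin N) (fun _ => α) (fun _ => β)
  have hpos : ∀ X : Matrix (Fin N → α) (Fin N → α) ℂ, X.PosSemidef →
      ((X ⊗ₖ (1 : Matrix (Fin N → β) (Fin N → β) ℂ)).submatrix e e).PosSemidef := fun X hX =>
    (hX.kronecker Matrix.PosSemidef.one).submatrix e
  have htr : ∀ ρ : Matrix (α × β) (α × β) ℂ,
      ((T ⊗ₖ (1 : Matrix (Fin N → β) (Fin N → β) ℂ)).submatrix e e * tensorPower N ρ).trace =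
        (T * tensorPower N (partialTraceB ρ)).trace := by
    intro ρ
    have hpt : ∀ i j, tensorPower N (partialTraceB ρ) i j =
        ∑ b : Fin N → β, tensorPower N ρ (e.symm (i, b)) (e.symm (j, b)) := by
      intro i j
      simp only [tensorPower, partialTraceB, Matrix.of_apply]
      rw [Finset.prod_univ_sum, Fintype.piFinset_univ]
      rfl
    simp only [Matrix.trace, Matrix.diag_apply, Matrix.mul_apply, hpt]
    rw [← Equiv.sum_comp e.symm, Fintype.sum_prod_type]
    refine Finset.sum_congr rfl fun i _ => ?_
    trans ∑ b : Fin N → β, ∑ j, T i j * tensorPower N ρ (e.symm (j, b)) (e.symm (i, b))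
    · refine Finset.sum_congr rfl fun b _ => ?_
      rw [← Equiv.sum_comp e.symm, Fintype.sum_prod_type]
      simp [Matrix.one_apply]
    · rw [Finset.sum_comm]
      simp only [Finset.mul_sum]
  refine ⟨_, hpos T hT.nonneg, ?_, ?_, ?_⟩
  · have := hpos _ hT.le_one
    have hsub : (1 - T) ⊗ₖ (1 : Matrix (Fin N → β) (Fin N → β) ℂ) = 1 ⊗ₖ 1 - T ⊗ₖ 1 := by
      ext x y
      simp only [Matrix.kroneckerMap_apply, Matrix.sub_apply, sub_mul]
    rwa [hsub, Matrix.one_kronecker_one, Matrix.submatrix_sub, Pi.sub_apply,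
      Pi.sub_apply, Matrix.submatrix_one_equiv] at this
  · rintro _ ⟨ψ, hψ, rfl⟩
    rw [htr]
    exact hT.complete _ hψ.2
  · rintro _ ⟨ψ, hψ, rfl⟩
    rw [htr]
    exact hT.sound _ hψ.2

theorem corollary1p5 (dA dB : ℕ) (hd : dA ≤ dB) (Q : StateProperty (Fin dA))
    (c s : ℝ) (hs : 0 ≤ s) (hsc : s < c) (hc : c ≤ 1) :
    sampleComplexity c s (purify (Fin dB) Q) = sampleComplexity c s Q := by
  have hE : ((1 : Matrix (Fin dB) (Fin dB) ℂ).submatrix id (Fin.castLE hd)).conjTranspose *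
      (1 : Matrix (Fin dB) (Fin dB) ℂ).submatrix id (Fin.castLE hd) = 1 := by
    rw [Matrix.conjTranspose_submatrix, Matrix.conjTranspose_one,
      ← Matrix.submatrix_mul _ _ _ _ _ Function.bijective_id, Matrix.one_mul,
      Matrix.submatrix_one _ (Fin.castLE_injective hd)]
  have h : ∀ N, (∃ T, IsTester c s (purify (Fin dB) Q) N T) ↔ ∃ T, IsTester c s Q N T := fun N =>
    ⟨fun ⟨_, hT⟩ => hT.exists_of_purify hE, fun ⟨_, hT⟩ => hT.exists_purify⟩
  simp only [sampleComplexity, h]
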